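/- **Conventions.** Graphs are finite, simple and undirected. For graphs $F,G$ with non-empty vertex sets let $t(F,G)$ be the probability that a uniformly random map $V(F)\to V(G)$ is a graph homomorphism. Identify a graph $G$ (up to isomorphism) with the point $\big((t(F,G))_F,\,1/|G|\big)$ of the product space $[0,1]^{\mathcal U}\times[0,1]$, where $F$ ranges over the countable set $\mathcal U$ of finite graphs. The closure $\overline{\mathcal U}$ of the set of all graphs is a compact metrizable space; its points with last coordinate $0$ are the graph limits. The graph limit $\Gamma_W$ represented by a symmetric measurable function (kernel) $W:\mathcal S^2\to[0,1]$ on a probability space $(\mathcal S,\mu)$ is the one with coordinates $$t(F,\Gamma_W)=\int_{\mathcal S^{V(F)}}\prod_{\{i,j\}\in E(F)}W(x_i,x_j)\,\prod_{i\in V(F)} d\mu(x_i).$$ **Construction.** For each $n\ge 1$ let $\nu_n$ be a probability distribution on $\{0,\dots,n-1\}$. Let $G_1$ be the graph with a single vertex. For $n\ge2$, let $D_n\sim\nu_n$ and form $G_n$ from $G_{n-1}$ by adding a new vertex and joining it to $D_n$ of the $n-1$ existing vertices, chosen uniformly at random among all $\binom{n-1}{D_n}$ possibilities; $D_n$ and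 the choice of vertices are independent of $G_{n-1}$. **Theorem.** Let the random graphs $G_n$ be given by this construction, and suppose that $D_n/n$ converges in distribution to a probability measure $\nu$ on $[0,1]$ as $n\to\infty$. Let $\Gamma_\nu=\Gamma_W$ be represented by the kernel $W$ on the probability space $\big([0,1]^2,\ \nu\times\lambda\big)$, with $\lambda$ the Lebesgue measure, defined by $$W\big((s_1,t_1),(s_2,t_2)\big)=\begin{cases}s_2,& t_1<t_2,\\ s_1,& t_1>t_2,\\ 0,&t_1=t_2.\end{cases}$$ Then $\Gamma_\nu$ is a graph limit, and $G_n\to\Gamma_\nu$ in probability in $\overline{\mathcal U}$ as $n\to\infty$; that is, for every neighbourhood $U$ of $\Gamma_\nu$ in $\overline{\mathcal U}$, $\mathbb P(G_n\notin U)\to0$. -/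

import Mathlib

open MeasureTheory ProbabilityTheory Filter Topology
open scoped unitInterval ENNReal

namespace GraphLimits

/-! ### Convergence in probability to a point -/

/-- `X n` converges in probability to the point `x` of a topological space: every neighbourhood
of `x` contains `X n` with probability tending to one. In a metrizable space this is the usual
notion, whatever metric is chosen (see `tendstoInProb_iff_tendstoInMeasure`). -/
def TendstoInProb {Ω S : Type*} [MeasurableSpace Ω] [TopologicalSpace S]
    (P : Measure Ω) (X : ℕ → Ω → S) (x : S) : Prop :=
  ∀ U ∈ 𝓝 x, Tendsto (fun n => P {ω | X n ω ∉ U}) atTop (𝓝 0)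

theorem tendstoInProb_iff_tendstoInMeasure {Ω S : Type*} [MeasurableSpace Ω]
    [PseudoEMetricSpace S] (P : Measure Ω) (X : ℕ → Ω → S) (x : S) :
    TendstoInProb P X x ↔ TendstoInMeasure P X atTop (fun _ => x) := by
  constructor
  · intro h ε hε
    refine (h (Metric.eball x ε) (Metric.eball_mem_nhds x hε)).congr fun n => ?_
    simp [Metric.mem_eball]
  · intro h U hU
    obtain ⟨ε, hε, hsub⟩ := EMetric.mem_nhds_iff.1 hU
    refine tendsto_of_tendsto_of_tendsto_of_le_of_le tendsto_const_nhds (h ε hε)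
      (fun _ => zero_le) (fun n => measure_mono fun ω hω => ?_)
    by_contra hlt
    exact hω (hsub (by simpa [Metric.mem_eball] using hlt))

/-! ### Graphs, homomorphism densities and the space of graphs and graph limits -/

/-- All finite non-empty graphs, up to relabelling of the vertices: `⟨n, G⟩` is a graph `G` with
the `n + 1` vertices `0, …, n`. -/
abbrev FinGraph : Type := Σ n : ℕ, SimpleGraph (Fin (n + 1))

/-- `t(F, G)`: the probability that a uniformly random map `V(F) → V(G)` is a graph
homomorphism. -/
noncomputable def homDensity {V V' : Type*} [Fintype V] [Fintype V']
    (F : SimpleGraph V) (G : SimpleGraph V') : ℝ :=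
  (Nat.card (F →g G) : ℝ) / (Fintype.card V' : ℝ) ^ Fintype.card V

/-- The coordinates `((t(F, G))_F, 1 / |G|)` of a graph `G`. The last one separates the graphs
from the graph limits, for which it is `0`. Isomorphic graphs have the same coordinates. -/
noncomputable def graphCoords (G : FinGraph) : (FinGraph → ℝ) × ℝ :=
  (fun F => homDensity F.2 G.2, 1 / ((G.1 : ℝ) + 1))

/-- The compact metrizable space of all graphs and graph limits: the closure of the set of graphs,
in the product topology of their coordinates. Its points with last coordinate `0` are the graph
limits, i.e. the families `(t_F)_F` that occur as `lim t(F, G_n)` with `|G_n| → ∞`. -/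
abbrev GraphSpace : Type := closure (Set.range graphCoords)

/-- A finite graph as a point of the space of graphs and graph limits. -/
noncomputable def GraphSpace.ofGraph (G : FinGraph) : GraphSpace :=
  ⟨graphCoords G, subset_closure (Set.mem_range_self G)⟩

/-! ### Graphons -/

/-- A kernel, or graphon, on a measurable space `S`. -/
structure Graphon (S : Type*) [MeasurableSpace S] where
  toFun : S → S → ℝ
  measurable' : Measurable (Function.uncurry toFun)
  symm' : ∀ x y, toFun x y = toFun y x
  mem_Icc' : ∀ x y, toFun x y ∈ Set.Icc (0 : ℝ) 1

open Classical in
/-- `t(F, W)`: the integral of `∏ W(x_i, x_j)`, the product being over the edges `ij` of `F`, with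
respect to independent points `x_i` with distribution `μ`. -/
noncomputable def Graphon.homDensity {S : Type*} [MeasurableSpace S] (μ : Measure S)
    (W : Graphon S) (F : FinGraph) : ℝ :=
  ∫ x : Fin (F.1 + 1) → S,
    ∏ p : Fin (F.1 + 1) × Fin (F.1 + 1) with p.1 < p.2 ∧ F.2.Adj p.1 p.2,
      W.toFun (x p.1) (x p.2) ∂(Measure.pi fun _ => μ)

/-- The coordinates of the graph limit represented by the graphon `W` on `(S, μ)`. -/
noncomputable def Graphon.limitCoords {S : Type*} [MeasurableSpace S] (μ : Measure S)
    (W : Graphon S) : (FinGraph → ℝ) × ℝ :=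
  (W.homDensity μ, 0)

/-- The kernel on `[0,1]²` with `W((s₁,t₁),(s₂,t₂)) = s₂` if `t₁ < t₂`, `= s₁` if `t₁ > t₂`,
and `= 0` if `t₁ = t₂`. -/
noncomputable def growthGraphon : Graphon (I × I) where
  toFun x y := if x.2 < y.2 then (y.1 : ℝ) else if y.2 < x.2 then (x.1 : ℝ) else 0
  measurable' := by
    refine Measurable.ite (measurableSet_lt (by fun_prop) (by fun_prop)) (by fun_prop) ?_
    exact Measurable.ite (measurableSet_lt (by fun_prop) (by fun_prop)) (by fun_prop) (by fun_prop)
  symm' x y := by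
    rcases lt_trichotomy x.2 y.2 with h | h | h
    · simp [h, h.not_gt]
    · simp [h]
    · simp [h, h.not_gt]
  mem_Icc' x y := by
    split_ifs
    · exact y.1.2
    · exact x.1.2
    · simp

/-! ### The sequential construction -/

instance (n : ℕ) : MeasurableSpace (SimpleGraph (Fin n)) := ⊤

instance (n : ℕ) : MeasurableSpace (Finset (Fin n)) := ⊤

/-- Add a new vertex (the last one) to `H` and join it to the vertices in `S`. -/
def addVertex {n : ℕ} (H : SimpleGraph (Fin n)) (S : Finset (Fin n)) :
    SimpleGraph (Fin (n + 1)) :=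
  H.map Fin.castSuccEmb ⊔
    SimpleGraph.fromEdgeSet {e | ∃ i ∈ S, e = s(i.castSucc, Fin.last n)}

/-- The growing random graphs. `G n` is the random graph on `n` vertices, and `G (n + 1)` arises
from it by adding a new vertex, which is joined to the vertices of a random set `N n`. The number
`D n` of these vertices has the distribution `ν n`, which is any distribution on `{0, …, n}`; given
`D n = d`, all `n.choose d` sets of `d` vertices are equally likely; and `(D n, N n)` is independent
of `G n` (hence also of the earlier graphs, which are restrictions of `G n`).

The numbering is by the number of old vertices: `ν n` and `D n` belong to vertex number `n + 1`.
There is exactly one graph with vertex set `Fin 1`, so that `G 1` is a single vertex. -/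
structure IsSequentialConstruction {Ω : Type*} [MeasurableSpace Ω] (P : Measure Ω)
    (ν : (n : ℕ) → PMF (Fin (n + 1))) (D : (n : ℕ) → Ω → Fin (n + 1))
    (N : (n : ℕ) → Ω → Finset (Fin n)) (G : (n : ℕ) → Ω → SimpleGraph (Fin n)) : Prop where
  measurable_D : ∀ n, Measurable (D n)
  measurable_N : ∀ n, Measurable (N n)
  measurable_G : ∀ n, Measurable (G n)
  law_D : ∀ n, P.map (D n) = (ν n).toMeasure
  card_N : ∀ n, ∀ᵐ ω ∂P, (N n ω).card = (D n ω : ℕ)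
  uniform_N : ∀ n (d : Fin (n + 1)) (S : Finset (Fin n)), S.card = (d : ℕ) →
    P {ω | D n ω = d ∧ N n ω = S} = P {ω | D n ω = d} / (n.choose d : ℝ≥0∞)
  indep : ∀ n, IndepFun (fun ω => (D n ω, N n ω)) (G n) P
  step : ∀ n, ∀ᵐ ω ∂P, G (n + 1) ω = addVertex (G n ω) (N n ω)

end GraphLimits

open GraphLimits

namespace GraphLimits

/-! Fix a graph F and an injective placement of its vertices among those of the random graph. The
placement is a homomorphism iff every vertex, at its birth, picks all its F-neighbours born earlier.
Distinct births are independent, and birth into n old vertices picks a given set of a of them with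
probability E[(D)_a / (n)_a], where (x)_a is the falling factorial. So the probability of a
homomorphism is a product over the vertices of F (`real_hom`), with a the number of earlier
neighbours. For late births each factor tends to the moment ∫ s^a dν.

A uniformly random placement has birth times that, rescaled, become independent uniform points of
[0,1], almost surely distinct and positive. Hence E t(F, G_n) tends to the average over these times
of the product of moments (`limitDensity`). This is t(F, W): each edge contributes the s-value of
its later endpoint, and integrating out the s-values first leaves the same moments.

Concentration is a second-moment argument: t(F, G)² = t(F ⊕ F, G), and the limit is multiplicative
over disjoint unions, so the variance tends to 0. The coordinates `1 / |G|` are deterministic, and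
in the product topology coordinatewise convergence in probability suffices. -/

/-- The number of neighbours of `j` that come before `j` in the order given by `t`. -/
noncomputable def backDegree {V α : Type*} [LT α] (F : SimpleGraph V) (t : V → α) (j : V) : ℕ :=
  Nat.card {i // F.Adj i j ∧ t i < t j}

/-- The probability that the new vertex joined to `n` old ones is adjacent to `a` given ones. -/
noncomputable def attachProb {Ω : Type*} [MeasurableSpace Ω] (P : Measure Ω)
    (D : (n : ℕ) → Ω → Fin (n + 1)) (n a : ℕ) : ℝ :=
  ∫ ω, ((D n ω : ℕ).descFactorial a : ℝ) / (n.descFactorial a : ℝ) ∂P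

/-! ### Probability that the random graph contains a given labelled graph -/

/-- Both sides are the proportion of (a + m)-subsets of an n-set that contain a given a-subset. -/
theorem choose_div_choose {n a m : ℕ} (h : a + m ≤ n) :
    ((n - a).choose m : ℝ) / (n.choose (a + m) : ℝ) =
      ((a + m).descFactorial a : ℝ) / (n.descFactorial a : ℝ) := by
  have h1 : 0 < n.choose (a + m) := Nat.choose_pos h
  have h2 : 0 < n.descFactorial a := Nat.descFactorial_pos.2 (by omega)
  rw [div_eq_div_iff (by positivity) (by positivity)]
  have h3 := Nat.choose_mul (n := n) (k := a + m) (s := a) (by omega)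
  rw [Nat.add_sub_cancel_left] at h3
  rw [Nat.descFactorial_eq_factorial_mul_choose, Nat.descFactorial_eq_factorial_mul_choose]
  push_cast
  have h4 : (n.choose (a + m) : ℝ) * (a + m).choose a = n.choose a * (n - a).choose m := by
    exact_mod_cast h3
  linear_combination -(a.factorial : ℝ) * h4

namespace IsSequentialConstruction

variable {Ω : Type*} [MeasurableSpace Ω] {P : Measure Ω}
  {νs : (n : ℕ) → PMF (Fin (n + 1))} {D : (n : ℕ) → Ω → Fin (n + 1)}
  {N : (n : ℕ) → Ω → Finset (Fin n)} {G : (n : ℕ) → Ω → SimpleGraph (Fin n)}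

theorem integral_comp_D [IsProbabilityMeasure P] (hG : IsSequentialConstruction P νs D N G)
    (n : ℕ) (f : ℕ → ℝ) :
    ∫ ω, f (D n ω) ∂P = ∑ d : Fin (n + 1), P.real {ω | D n ω = d} * f d := by
  have h := integral_map (μ := P) (hG.measurable_D n).aemeasurable
    (f := fun d : Fin (n + 1) => f d) (Measurable.of_discrete.aestronglyMeasurable)
  have : IsProbabilityMeasure (P.map (D n)) :=
    Measure.isProbabilityMeasure_map (hG.measurable_D n).aemeasurable
  rw [← h, integral_fintype Integrable.of_finite]
  refine Finset.sum_congr rfl fun d _ => ?_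
  rw [map_measureReal_apply (hG.measurable_D n) (measurableSet_singleton d), smul_eq_mul]
  rfl

theorem real_N_eq (hG : IsSequentialConstruction P νs D N G) (n : ℕ) (S : Finset (Fin n)) :
    P.real {ω | N n ω = S} =
      P.real {ω | (D n ω : ℕ) = S.card} / (n.choose S.card : ℝ) := by
  have hS : S.card < n + 1 := Nat.lt_succ_of_le (by simpa using S.card_le_univ)
  have h := hG.uniform_N n ⟨S.card, hS⟩ S rfl
  -- Almost surely `D n` is the size of `N n`, so the value of `N n` already fixes that of `D n`.
  have e1 : P {ω | N n ω = S} = P {ω | D n ω = ⟨S.card, hS⟩ ∧ N n ω = S} := by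
    refine measure_congr ?_
    filter_upwards [hG.card_N n] with ω hω
    refine propext ⟨fun (hN : N n ω = S) => ⟨?_, hN⟩, fun hN => hN.2⟩
    ext
    rw [← hω, hN]
  simp only [Measure.real, e1, h, ENNReal.toReal_div, ENNReal.toReal_natCast]
  simp [Fin.ext_iff]

theorem real_subset_N [IsProbabilityMeasure P] (hG : IsSequentialConstruction P νs D N G)
    (n : ℕ) (A : Finset (Fin n)) :
    P.real {ω | A ⊆ N n ω} = attachProb P D n A.card := by
  classical
  have hA : A.card ≤ n := by simpa using A.card_le_univ
  set p : ℕ → ℝ := fun d => P.real {ω | (D n ω : ℕ) = d} with hp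
  have e1 : P.real {ω | A ⊆ N n ω} =
      ∑ S ∈ Finset.Icc A Finset.univ, p S.card / (n.choose S.card : ℝ) := by
    have : {ω | A ⊆ N n ω} = ⋃ S ∈ Finset.Icc A Finset.univ, {ω | N n ω = S} := by
      ext ω; simp
    rw [this, measureReal_biUnion_finset]
    · exact Finset.sum_congr rfl fun S _ => hG.real_N_eq n S
    · intro S _ T _ hST
      exact Set.disjoint_left.2 fun ω (h1 : N n ω = S) (h2 : N n ω = T) => hST (h1 ▸ h2)
    · intro S _
      exact hG.measurable_N n (measurableSet_singleton S)
  -- Group the supersets of `A` by their number m of additional elements.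
  have e2 : ∑ S ∈ Finset.Icc A Finset.univ, p S.card / (n.choose S.card : ℝ) =
      ∑ m ∈ Finset.range (n - A.card + 1),
        (n - A.card).choose m • (p (A.card + m) / (n.choose (A.card + m) : ℝ)) := by
    have hc : (Finset.univ \ A).card = n - A.card := by
      rw [Finset.card_sdiff_of_subset (Finset.subset_univ _)]; simp
    rw [Finset.Icc_eq_image_powerset (Finset.subset_univ A), Finset.sum_image]
    · rw [← hc, ← Finset.sum_powerset_apply_card
        (fun m => p (A.card + m) / (n.choose (A.card + m) : ℝ))]
      refine Finset.sum_congr rfl fun T hT => ?_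
      rw [Finset.card_union_of_disjoint]
      exact (Finset.disjoint_sdiff).mono_right (Finset.mem_powerset.1 hT)
    · intro S hS T hT hST
      have hS' := Finset.disjoint_sdiff.mono_right (Finset.mem_powerset.1 hS)
      have hT' := Finset.disjoint_sdiff.mono_right (Finset.mem_powerset.1 hT)
      have := congrArg (· \ A) hST
      simpa [Finset.union_sdiff_cancel_left hS', Finset.union_sdiff_cancel_left hT'] using this
  rw [e1, e2, attachProb,
    hG.integral_comp_D n fun d => (d.descFactorial A.card : ℝ) / (n.descFactorial A.card : ℝ)]
  have e3 : ∀ d : Fin (n + 1), P.real {ω | D n ω = d} = p d := fun d => by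
    simp [hp, Fin.ext_iff]
  simp only [e3]
  rw [Fin.sum_univ_eq_sum_range
    (fun d => p d * ((d.descFactorial A.card : ℝ) / (n.descFactorial A.card : ℝ))) (n + 1)]
  have e4 := Finset.sum_range_add
    (fun d => p d * ((d.descFactorial A.card : ℝ) / (n.descFactorial A.card : ℝ)))
    A.card (n - A.card + 1)
  -- Degrees below `A.card` contribute nothing, since their falling factorial is zero.
  rw [show A.card + (n - A.card + 1) = n + 1 by omega,
    Finset.sum_eq_zero (s := Finset.range A.card), zero_add] at e4
  · rw [e4]
    refine Finset.sum_congr rfl fun m hm => ?_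
    rw [← choose_div_choose (by have := Finset.mem_range.1 hm; omega), nsmul_eq_mul]
    ring
  · intro d hd
    rw [Nat.descFactorial_eq_zero_iff_lt.2 (Finset.mem_range.1 hd)]
    simp

end IsSequentialConstruction

theorem le_addVertex_iff {n : ℕ} (H : SimpleGraph (Fin (n + 1))) (K : SimpleGraph (Fin n))
    (S : Finset (Fin n)) :
    H ≤ addVertex K S ↔
      H.comap Fin.castSucc ≤ K ∧ ∀ i, H.Adj i.castSucc (Fin.last n) → i ∈ S := by
  have hcc : ∀ i j : Fin n, (addVertex K S).Adj i.castSucc j.castSucc ↔ K.Adj i j := by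
    intro i j
    simp only [addVertex, SimpleGraph.sup_adj, SimpleGraph.map_adj, SimpleGraph.fromEdgeSet_adj,
      Set.mem_ofPred_eq, Sym2.eq_iff]
    constructor
    · rintro (⟨u, v, h, h1, h2⟩ | ⟨⟨k, _, h | h⟩, _⟩)
      · rw [← Fin.castSucc_injective n h1, ← Fin.castSucc_injective n h2]; exact h
      · exact absurd h.2 (Fin.castSucc_lt_last j).ne
      · exact absurd h.1 (Fin.castSucc_lt_last i).ne
    · exact fun h => Or.inl ⟨i, j, h, rfl, rfl⟩
  have hcl : ∀ i : Fin n, (addVertex K S).Adj i.castSucc (Fin.last n) ↔ i ∈ S := by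
    intro i
    simp only [addVertex, SimpleGraph.sup_adj, SimpleGraph.map_adj, SimpleGraph.fromEdgeSet_adj,
      Set.mem_ofPred_eq, Sym2.eq_iff]
    constructor
    · rintro (⟨u, v, h, h1, h2⟩ | ⟨⟨k, hk, h | h⟩, _⟩)
      · exact absurd h2 (Fin.castSucc_lt_last v).ne
      · rwa [Fin.castSucc_injective n h.1]
      · exact absurd h.1 (Fin.castSucc_lt_last i).ne
    · exact fun h => Or.inr ⟨⟨i, h, Or.inl ⟨rfl, trivial⟩⟩, (Fin.castSucc_lt_last i).ne⟩
  constructor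
  · exact fun h => ⟨fun i j hij => (hcc i j).1 (h hij), fun i hi => (hcl i).1 (h hi)⟩
  · rintro ⟨h1, h2⟩ i j hij
    induction i using Fin.lastCases with
    | last =>
      induction j using Fin.lastCases with
      | last => exact absurd rfl hij.ne
      | cast j => exact ((hcl j).2 (h2 j hij.symm)).symm
    | cast i =>
      induction j using Fin.lastCases with
      | last => exact (hcl i).2 (h2 i hij)
      | cast j => exact (hcc i j).2 (h1 hij)

namespace IsSequentialConstruction

variable {Ω : Type*} [MeasurableSpace Ω] {P : Measure Ω}
  {νs : (n : ℕ) → PMF (Fin (n + 1))} {D : (n : ℕ) → Ω → Fin (n + 1)}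
  {N : (n : ℕ) → Ω → Finset (Fin n)} {G : (n : ℕ) → Ω → SimpleGraph (Fin n)}

/-- Induction on the births: the condition on the last vertex involves only `N n`, which is
independent of the condition on the older vertices. -/
theorem real_le [IsProbabilityMeasure P] (hG : IsSequentialConstruction P νs D N G)
    (n : ℕ) (H : SimpleGraph (Fin n)) :
    P.real {ω | H ≤ G n ω} = ∏ k : Fin n, attachProb P D k (backDegree H id k) := by
  classical
  induction n with
  | zero =>
    have : {ω | H ≤ G 0 ω} = Set.univ := Set.eq_univ_of_forall fun ω i => i.elim0
    rw [this]
    simp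
  | succ n ih =>
    set A : Finset (Fin n) := {i | H.Adj i.castSucc (Fin.last n)} with hA
    have e1 : P.real {ω | H ≤ G (n + 1) ω} =
        P.real ({ω | A ⊆ N n ω} ∩ {ω | H.comap Fin.castSucc ≤ G n ω}) := by
      refine measureReal_congr ?_
      filter_upwards [hG.step n] with ω hω
      refine propext ?_
      change H ≤ G (n + 1) ω ↔ A ⊆ N n ω ∧ H.comap Fin.castSucc ≤ G n ω
      rw [hω, le_addVertex_iff, and_comm]
      simp [hA, Finset.subset_iff]
    have e2 := (hG.indep n).measure_inter_preimage_eq_mul {x | A ⊆ x.2}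
      {K | H.comap Fin.castSucc ≤ K} (measurable_snd (t := {x | A ⊆ x})
        (MeasurableSpace.measurableSet_top)) MeasurableSpace.measurableSet_top
    have e3 : P.real ({ω | A ⊆ N n ω} ∩ {ω | H.comap Fin.castSucc ≤ G n ω}) =
        P.real {ω | A ⊆ N n ω} * P.real {ω | H.comap Fin.castSucc ≤ G n ω} := by
      simpa [Measure.real] using congrArg ENNReal.toReal e2
    rw [e1, e3, hG.real_subset_N, ih, Fin.prod_univ_castSucc, mul_comm]
    congr 1
    · refine Finset.prod_congr rfl fun k _ => ?_
      congr 1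
      refine Nat.card_congr ⟨fun i => ⟨i.1.castSucc, i.2⟩,
        fun i => ⟨i.1.castPred (i.2.2.trans_le (Fin.le_last _)).ne, ?_⟩, ?_, ?_⟩
      · simpa [Fin.lt_def] using i.2
      · intro i; simp
      · intro i; simp
    · rw [Fin.val_last]
      congr 1
      rw [← Nat.card_eq_finsetCard A]
      refine Nat.card_congr ⟨fun i => ⟨i.1.castSucc, (Finset.mem_filter.1 i.2).2, ?_⟩,
        fun i => ⟨i.1.castPred (i.2.2.trans_le (Fin.le_last _)).ne, ?_⟩, ?_, ?_⟩
      · exact Fin.castSucc_lt_last _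
      · simpa [hA] using i.2.1
      · intro i; simp
      · intro i; simp

theorem attachProb_zero [IsProbabilityMeasure P] (k : ℕ) : attachProb P D k 0 = 1 := by simp [attachProb]

theorem real_hom [IsProbabilityMeasure P] (hG : IsSequentialConstruction P νs D N G)
    {V : Type*} [Fintype V] (F : SimpleGraph V) {n : ℕ} {φ : V → Fin n} (hφ : Function.Injective φ) :
    P.real {ω | ∀ i j, F.Adj i j → (G n ω).Adj (φ i) (φ j)} =
      ∏ j, attachProb P D (φ j) (backDegree F φ j) := by
  have e1 : {ω | ∀ i j, F.Adj i j → (G n ω).Adj (φ i) (φ j)} =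
      {ω | F.map (⟨φ, hφ⟩ : V ↪ Fin n) ≤ G n ω} := by
    ext ω
    change _ ↔ F.map (⟨φ, hφ⟩ : V ↪ Fin n) ≤ G n ω
    rw [SimpleGraph.map_le_iff_le_comap]
    exact ⟨fun h i j hij => h i j hij, fun h i j hij => h hij⟩
  rw [e1, hG.real_le]
  symm
  -- Vertices outside the image of `φ` are isolated in the image graph, hence contribute a factor 1.
  refine Fintype.prod_of_injective φ hφ _ _ (fun k hk => ?_) (fun j => ?_)
  · have : backDegree (F.map (⟨φ, hφ⟩ : V ↪ Fin n)) id k = 0 := by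
      refine Nat.card_eq_zero.2 (Or.inl ⟨fun i => ?_⟩)
      obtain ⟨u, v, _, _, h⟩ := (SimpleGraph.map_adj _ _ _ _).1 i.2.1
      exact hk ⟨v, h⟩
    rw [this, attachProb_zero]
  · congr 1
    refine Nat.card_congr (Equiv.ofBijective
      (fun i => ⟨φ i.1, (SimpleGraph.map_adj _ _ _ _).2 ⟨i.1, j, i.2.1, rfl, rfl⟩, i.2.2⟩)
      ⟨fun i i' h => Subtype.ext (hφ (by simpa using h)), fun k => ?_⟩)
    obtain ⟨u, v, huv, h1, h2⟩ := (SimpleGraph.map_adj _ _ _ _).1 k.2.1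
    have hv : v = j := hφ h2
    subst hv
    refine ⟨⟨u, huv, ?_⟩, Subtype.ext h1⟩
    have h3 := k.2.2
    simp only [id] at h3
    rw [← h1] at h3
    exact h3

end IsSequentialConstruction

/-! ### Convergence of the attachment probabilities to moments -/

theorem abs_sub_div_sub_div_le {d n i : ℕ} (hd : d ≤ n) (hi : i < n) :
    |((d - i : ℕ) : ℝ) / ((n - i : ℕ) : ℝ) - (d : ℝ) / (n + 1)| ≤ (i + 1) / ((n - i : ℕ) : ℝ) := by
  have hni : (0 : ℝ) < ((n - i : ℕ) : ℝ) := by exact_mod_cast Nat.sub_pos_of_lt hi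
  have hn : (0 : ℝ) < (n : ℝ) + 1 := by positivity
  have hd' : (d : ℝ) ≤ n := by exact_mod_cast hd
  have hi' : (i : ℝ) ≤ n := by exact_mod_cast hi.le
  have hi0 : (0 : ℝ) ≤ i := by positivity
  rcases le_or_gt i d with h | h
  · have h' : (i : ℝ) ≤ d := by exact_mod_cast h
    rw [div_sub_div _ _ hni.ne' hn.ne', abs_div, abs_of_pos (mul_pos hni hn),
      div_le_div_iff₀ (mul_pos hni hn) hni]
    have key : |((d - i : ℕ) : ℝ) * (n + 1) - ((n - i : ℕ) : ℝ) * d| ≤ (i + 1) * (n + 1) := by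
      rw [Nat.cast_sub h, Nat.cast_sub hi.le, abs_le]
      constructor <;> nlinarith
    calc _ ≤ ((i : ℝ) + 1) * (n + 1) * ((n - i : ℕ) : ℝ) := by gcongr
      _ = _ := by ring
  · have h' : (d : ℝ) ≤ i := by exact_mod_cast h.le
    rw [Nat.sub_eq_zero_of_le h.le, Nat.cast_zero, zero_div, zero_sub, abs_neg,
      abs_of_nonneg (by positivity)]
    refine div_le_div₀ (by positivity) (by linarith) hni ?_
    rw [Nat.cast_sub hi.le]
    linarith

/-- The falling factorial ratio is a product of factors (d - i)/(n - i), each close to d/(n + 1).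
Uniformity in `d` allows `d` to be replaced by the random degree. -/
theorem exists_descFactorial_div_sub_pow_le (a : ℕ) :
    ∃ ε : ℕ → ℝ, Tendsto ε atTop (𝓝 0) ∧ ∀ᶠ n : ℕ in atTop, ∀ d ≤ n,
      |(d.descFactorial a : ℝ) / (n.descFactorial a : ℝ) - ((d : ℝ) / (n + 1)) ^ a| ≤ ε n := by
  induction a with
  | zero => exact ⟨fun _ => 0, tendsto_const_nhds, Eventually.of_forall fun n d _ => by simp⟩
  | succ a ih =>
    obtain ⟨ε, hε, h⟩ := ih
    refine ⟨fun n => (a + 1) / ((n - a : ℕ) : ℝ) + ε n, ?_, ?_⟩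
    · have h1 : Tendsto (fun n : ℕ => ((n - a : ℕ) : ℝ)) atTop atTop :=
        tendsto_natCast_atTop_atTop.comp (tendsto_sub_atTop_nat a)
      simpa using (h1.const_div_atTop ((a : ℝ) + 1)).add hε
    · filter_upwards [h, eventually_gt_atTop a] with n hn ha d hd
      have hx := abs_sub_div_sub_div_le hd ha
      have hy := hn d hd
      have hx1 : ((d - a : ℕ) : ℝ) / ((n - a : ℕ) : ℝ) ≤ 1 :=
        div_le_one_of_le₀ (by exact_mod_cast Nat.sub_le_sub_right hd a) (by positivity)
      have hx0 : 0 ≤ ((d - a : ℕ) : ℝ) / ((n - a : ℕ) : ℝ) := by positivity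
      have hd' : (d : ℝ) ≤ n := by exact_mod_cast hd
      have hz1 : ((d : ℝ) / (n + 1)) ^ a ≤ 1 :=
        pow_le_one₀ (by positivity) (div_le_one_of_le₀ (by linarith) (by positivity))
      have hz0 : 0 ≤ ((d : ℝ) / (n + 1)) ^ a := by positivity
      rw [Nat.descFactorial_succ, Nat.descFactorial_succ, Nat.cast_mul, Nat.cast_mul,
        mul_div_mul_comm, pow_succ']
      set x := ((d - a : ℕ) : ℝ) / ((n - a : ℕ) : ℝ)
      set y := (d.descFactorial a : ℝ) / (n.descFactorial a : ℝ)
      set z := ((d : ℝ) / (n + 1)) ^ a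
      set w := (d : ℝ) / (n + 1)
      calc |x * y - w * z| = |x * (y - z) + (x - w) * z| := by ring_nf
        _ ≤ |x * (y - z)| + |(x - w) * z| := abs_add_le _ _
        _ = x * |y - z| + |x - w| * z := by
          rw [abs_mul, abs_mul, abs_of_nonneg hx0, abs_of_nonneg hz0]
        _ ≤ 1 * ε n + ((a + 1) / ((n - a : ℕ) : ℝ)) * 1 := by
          gcongr
        _ = _ := by ring

theorem tendsto_attachProb {Ω : Type*} [MeasurableSpace Ω] {P : Measure Ω}
    [IsProbabilityMeasure P] {D : (n : ℕ) → Ω → Fin (n + 1)} (hDm : ∀ n, Measurable (D n))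
    {ν : Measure I} [IsProbabilityMeasure ν]
    (hD : TendstoInDistribution (fun n ω => ((D n ω : ℕ) : ℝ) / ((n : ℝ) + 1)) atTop
      (fun x : I => (x : ℝ)) (fun _ => P) ν) (a : ℕ) :
    Tendsto (fun n => attachProb P D n a) atTop (𝓝 (∫ x : I, (x : ℝ) ^ a ∂ν)) := by
  have hle : ∀ n ω, (D n ω : ℕ) ≤ n := fun n ω => Nat.lt_succ_iff.1 (D n ω).2
  have hmeas : ∀ n (f : ℕ → ℝ), Measurable fun ω => f (D n ω) := fun n f =>
    (Measurable.of_discrete (f := fun d : Fin (n + 1) => f d)).comp (hDm n)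
  have hint : ∀ n (f : ℕ → ℝ), Integrable (fun ω => f (D n ω)) P := fun n f => by
    refine Integrable.of_bound (hmeas n f).aestronglyMeasurable
      (∑ d ∈ Finset.range (n + 1), ‖f d‖) (Eventually.of_forall fun ω => ?_)
    exact Finset.single_le_sum (f := fun d => ‖f d‖) (fun _ _ => norm_nonneg _)
      (Finset.mem_range.2 (D n ω).2)
  have hpow : Tendsto (fun n => ∫ ω, (((D n ω : ℕ) : ℝ) / ((n : ℝ) + 1)) ^ a ∂P) atTop
      (𝓝 (∫ x : I, (x : ℝ) ^ a ∂ν)) := by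
    -- The power is unbounded on ℝ; clamping its argument to [0,1] gives a test function for weak
    -- convergence that agrees with it on all values taken.
    let f : BoundedContinuousFunction ℝ ℝ :=
      BoundedContinuousFunction.ofNormedAddCommGroup
        (fun x => (Set.projIcc (0 : ℝ) 1 zero_le_one x : ℝ) ^ a)
        ((continuous_subtype_val.comp continuous_projIcc).pow a) 1 fun x => by
          have h := (Set.projIcc (0 : ℝ) 1 zero_le_one x).2
          rw [Real.norm_of_nonneg (pow_nonneg h.1 _)]
          exact pow_le_one₀ h.1 h.2
    have hf : ∀ x ∈ Set.Icc (0 : ℝ) 1, f x = x ^ a := fun x hx => by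
      simp [f, Set.projIcc_of_mem zero_le_one hx]
    have h := (ProbabilityMeasure.tendsto_iff_forall_integral_tendsto.1 hD.tendsto) f
    simp only [ProbabilityMeasure.coe_mk] at h
    rw [integral_map hD.aemeasurable_limit f.continuous.aestronglyMeasurable] at h
    have e : ∫ x : I, f x ∂ν = ∫ x : I, (x : ℝ) ^ a ∂ν :=
      integral_congr_ae (Eventually.of_forall fun x => hf x x.2)
    rw [e] at h
    refine h.congr fun n => ?_
    rw [integral_map (hD.forall_aemeasurable n) f.continuous.aestronglyMeasurable]
    refine integral_congr_ae (Eventually.of_forall fun ω => hf _ ⟨by positivity, ?_⟩)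
    have : ((D n ω : ℕ) : ℝ) ≤ n := by exact_mod_cast hle n ω
    exact div_le_one_of_le₀ (by linarith) (by positivity)
  obtain ⟨ε, hε, h⟩ := exists_descFactorial_div_sub_pow_le a
  have hdiff : Tendsto (fun n => attachProb P D n a -
      ∫ ω, (((D n ω : ℕ) : ℝ) / ((n : ℝ) + 1)) ^ a ∂P) atTop (𝓝 0) := by
    refine squeeze_zero_norm' ?_ hε
    filter_upwards [h] with n hn
    rw [attachProb, ← integral_sub
      (hint n fun d => (d.descFactorial a : ℝ) / (n.descFactorial a : ℝ))
      (hint n fun d => ((d : ℝ) / (n + 1)) ^ a)]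
    refine (norm_integral_le_of_norm_le_const (C := ε n)
      (Eventually.of_forall fun ω => ?_)).trans_eq (by simp)
    exact hn (D n ω) (hle n ω)
  simpa using hdiff.add hpow

/-! ### Uniformly random vertices as functions of uniformly random points of the unit interval -/

/-- The cell containing `t` when the unit interval is divided into `n + 1` cells of equal length. -/
noncomputable def gridCell (n : ℕ) (t : I) : Fin (n + 1) :=
  ⟨min ⌊((n : ℝ) + 1) * t⌋₊ n, by omega⟩

/-- The `min` in `gridCell` matters only at t = 1, a null set. -/
theorem measurable_gridCell (n : ℕ) : Measurable (gridCell n) := by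
  have h : Measurable fun t : I => min ⌊((n : ℝ) + 1) * t⌋₊ n :=
    (Measurable.of_discrete (f := fun k : ℕ => min k n)).comp
      (Nat.measurable_floor.comp (by fun_prop))
  refine measurable_to_countable' fun i => ?_
  convert h (measurableSet_singleton (i : ℕ)) using 1
  ext t
  simp [gridCell, Fin.ext_iff]

theorem coe_gridCell {n : ℕ} {t : I} (ht : (t : ℝ) < 1) :
    (gridCell n t : ℕ) = ⌊((n : ℝ) + 1) * t⌋₊ := by
  refine min_eq_left (Nat.lt_succ_iff.1 ((Nat.floor_lt (by have := t.2.1; positivity)).2 ?_))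
  push_cast
  nlinarith [(n.cast_nonneg : (0 : ℝ) ≤ n)]

theorem ae_coe_lt_one : ∀ᵐ t : I, (t : ℝ) < 1 := by
  have h : ∀ᵐ t : I, t ≠ 1 := by simp [ae_iff]
  filter_upwards [h] with t ht
  exact lt_of_le_of_ne t.2.2 fun h => ht (Subtype.ext h)

theorem map_gridCell_singleton (n : ℕ) (i : Fin (n + 1)) :
    ((volume : Measure I).map (gridCell n)).real {i} = 1 / ((n : ℝ) + 1) := by
  have hn : (0 : ℝ) < (n : ℝ) + 1 := by positivity
  have hi : ((i : ℕ) : ℝ) + 1 ≤ n + 1 := by exact_mod_cast i.2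
  let a : I := ⟨(i : ℕ) / ((n : ℝ) + 1), by positivity, (div_le_one hn).2 (by linarith)⟩
  let b : I := ⟨((i : ℕ) + 1) / ((n : ℝ) + 1), by positivity, (div_le_one hn).2 hi⟩
  have e : (gridCell n ⁻¹' {i} : Set I) =ᵐ[volume] Set.Ico a b := by
    filter_upwards [ae_coe_lt_one] with t ht
    refine propext ?_
    change gridCell n t = i ↔ a ≤ t ∧ t < b
    rw [Fin.ext_iff, coe_gridCell ht, Nat.floor_eq_iff (by have := t.2.1; positivity),
      ← Subtype.coe_le_coe, ← Subtype.coe_lt_coe, div_le_iff₀ hn, lt_div_iff₀ hn, mul_comm]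
  rw [map_measureReal_apply (measurable_gridCell n) (measurableSet_singleton i),
    measureReal_congr e, Measure.real, unitInterval.volume_Ico, ENNReal.toReal_ofReal]
  · simp only [a, b]
    ring
  · simp only [a, b, sub_nonneg]
    gcongr
    linarith

/-- Writes the average over all maps into n + 1 vertices as an integral over a space that does not
depend on n, so that dominated convergence applies. -/
theorem integral_gridCell {V : Type*} [Fintype V] [DecidableEq V] (n : ℕ) (h : (V → Fin (n + 1)) → ℝ) :
    ∫ t : V → I, h (fun j => gridCell n (t j)) =
      (∑ φ, h φ) / ((n : ℝ) + 1) ^ Fintype.card V := by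
  have hm : ∀ _ : V, AEMeasurable (gridCell n) (volume : Measure I) :=
    fun _ => (measurable_gridCell n).aemeasurable
  have : IsProbabilityMeasure ((volume : Measure I).map (gridCell n)) :=
    Measure.isProbabilityMeasure_map (measurable_gridCell n).aemeasurable
  have e := Measure.pi_map_pi (μ := fun _ : V => (volume : Measure I)) hm
  have hm' : Measurable fun (t : V → I) j => gridCell n (t j) :=
    measurable_pi_lambda _ fun j => (measurable_gridCell n).comp (measurable_pi_apply j)
  rw [volume_pi, ← integral_map (f := h) hm'.aemeasurable
    Measurable.of_discrete.aestronglyMeasurable, e, integral_fintype Integrable.of_finite,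
    Finset.sum_div]
  refine Finset.sum_congr rfl fun φ _ => ?_
  have : (Measure.pi fun _ : V => (volume : Measure I).map (gridCell n)).real {φ} =
      (1 / ((n : ℝ) + 1)) ^ Fintype.card V := by
    rw [Measure.real, Measure.pi_singleton, ENNReal.toReal_prod]
    exact (Finset.prod_congr rfl fun j _ => map_gridCell_singleton n (φ j)).trans (by simp)
  rw [this, smul_eq_mul, one_div, inv_pow]
  ring

theorem eventually_gridCell_lt {s t : I} (hst : s < t) (ht : (t : ℝ) < 1) :
    ∀ᶠ n : ℕ in atTop, gridCell n s < gridCell n t := by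
  have hst' : (s : ℝ) < t := hst
  have h : Tendsto (fun n : ℕ => ((n : ℝ) + 1) * ((t : ℝ) - s)) atTop atTop :=
    (tendsto_atTop_add_const_right _ _ tendsto_natCast_atTop_atTop).atTop_mul_const
      (sub_pos.2 hst')
  -- Once the rescaled points are at distance at least 1, their floors differ.
  filter_upwards [h.eventually_ge_atTop 1] with n hn
  rw [Fin.lt_def, coe_gridCell ht, coe_gridCell (hst'.trans ht), ← Nat.succ_le_iff,
    Nat.succ_eq_add_one, ← Nat.floor_add_one (by have := s.2.1; positivity)]
  exact Nat.floor_le_floor (by linarith)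

theorem tendsto_coe_gridCell {t : I} (h0 : 0 < (t : ℝ)) (h1 : (t : ℝ) < 1) :
    Tendsto (fun n => (gridCell n t : ℕ)) atTop atTop := by
  simp only [coe_gridCell h1]
  exact tendsto_nat_floor_atTop.comp
    ((tendsto_atTop_add_const_right _ _ tendsto_natCast_atTop_atTop).atTop_mul_const h0)

/-- Two coordinates are independent and atomless, so by Fubini the diagonal is null. -/
theorem ae_injective (V : Type*) [Fintype V] : ∀ᵐ t : V → I, Function.Injective t := by
  have h : ∀ i j : V, i ≠ j → ∀ᵐ t : V → I, t i ≠ t j := by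
    intro i j hij
    have hind := (iIndepFun_pi (μ := fun _ : V => (volume : Measure I)) (X := fun _ => id)
      fun _ => aemeasurable_id).indepFun hij
    have hmap := hind.map_prod_eq_prod_map_map (measurable_pi_apply i).aemeasurable
      (measurable_pi_apply j).aemeasurable
    have he : ∀ k : V, (Measure.pi fun _ : V => (volume : Measure I)).map
        (fun t => t k) = volume := fun k => (measurePreserving_eval _ k).map_eq
    rw [he, he] at hmap
    have hd : MeasurableSet {x : I × I | x.1 = x.2} := measurableSet_eq_fun (by fun_prop)
      (by fun_prop)
    have h0 : ((volume : Measure I).prod volume) {x : I × I | x.1 = x.2} = 0 := by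
      rw [Measure.measure_prod_null hd]
      refine Eventually.of_forall fun x => ?_
      have : (Prod.mk x ⁻¹' {x : I × I | x.1 = x.2} : Set I) = {x} := by
        ext y; simp [eq_comm]
      simp [this]
    rw [← hmap, Measure.map_apply (by fun_prop) hd] at h0
    rw [ae_iff, volume_pi]
    convert h0 using 2
    ext t
    simp
  have h' : ∀ᵐ t : V → I, ∀ i j : V, i ≠ j → t i ≠ t j :=
    ae_all_iff.2 fun i => ae_all_iff.2 fun j => by
      by_cases hij : i = j
      · simp [hij]
      · filter_upwards [h i j hij] with t ht _ using ht
  filter_upwards [h'] with t ht i j hij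
  by_contra hne
  exact ht i j hne hij

theorem ae_coe_mem_Ioo (V : Type*) [Fintype V] :
    ∀ᵐ t : V → I, ∀ j, 0 < (t j : ℝ) ∧ (t j : ℝ) < 1 := by
  refine ae_all_iff.2 fun j => ?_
  have h : ∀ᵐ t : I, 0 < (t : ℝ) ∧ (t : ℝ) < 1 := by
    have h0 : ∀ᵐ t : I, t ≠ 0 := by simp [ae_iff]
    filter_upwards [ae_coe_lt_one, h0] with t h1 h0
    exact ⟨lt_of_le_of_ne t.2.1 fun h => h0 (Subtype.ext h.symm), h1⟩
  exact (measurePreserving_eval (fun _ : V => (volume : Measure I)) j).quasiMeasurePreserving.ae h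

theorem eventually_gridCell_lt_iff {V : Type*} [Fintype V] {t : V → I}
    (ht : Function.Injective t) (h1 : ∀ j, (t j : ℝ) < 1) :
    ∀ᶠ n : ℕ in atTop, ∀ i j, gridCell n (t i) < gridCell n (t j) ↔ t i < t j := by
  have h : ∀ᶠ n : ℕ in atTop, ∀ i j, t i < t j → gridCell n (t i) < gridCell n (t j) := by
    refine eventually_all.2 fun i => eventually_all.2 fun j => ?_
    by_cases hij : t i < t j
    · filter_upwards [eventually_gridCell_lt hij (h1 j)] with n hn _ using hn
    · exact Eventually.of_forall fun n h => absurd h hij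
  filter_upwards [h] with n hn i j
  refine ⟨fun hij => ?_, hn i j⟩
  rcases lt_trichotomy (t i) (t j) with h' | h' | h'
  · exact h'
  · rw [ht h'] at hij
    exact absurd hij (lt_irrefl _)
  · exact absurd hij (hn j i h').not_gt

/-! ### Homomorphism densities -/

theorem homDensity_eq_sum {V : Type*} [Fintype V] [DecidableEq V] (F : SimpleGraph V)
    {n : ℕ} (K : SimpleGraph (Fin (n + 1))) :
    homDensity F K = (∑ φ : V → Fin (n + 1),
      Set.indicator {K : SimpleGraph (Fin (n + 1)) | ∀ i j, F.Adj i j → K.Adj (φ i) (φ j)}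
        (fun _ => (1 : ℝ)) K) / ((n : ℝ) + 1) ^ Fintype.card V := by
  classical
  have e : Nat.card (F →g K) =
      Nat.card {φ : V → Fin (n + 1) // ∀ i j, F.Adj i j → K.Adj (φ i) (φ j)} :=
    Nat.card_congr ⟨fun f => ⟨f, fun _ _ h => f.map_adj h⟩, fun f => ⟨f.1, fun h => f.2 _ _ h⟩,
      fun _ => rfl, fun _ => rfl⟩
  rw [homDensity, e, Nat.card_eq_fintype_card, Fintype.card_subtype, Fintype.card_fin]
  simp [Set.indicator_apply]

/-- A homomorphism from a disjoint union is a pair of homomorphisms. -/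
theorem homDensity_sum {V V' W : Type*} [Fintype V] [Fintype V'] [Fintype W]
    (F : SimpleGraph V) (F' : SimpleGraph V') (K : SimpleGraph W) :
    homDensity (F ⊕g F') K = homDensity F K * homDensity F' K := by
  have e : Nat.card ((F ⊕g F') →g K) = Nat.card (F →g K) * Nat.card (F' →g K) := by
    rw [← Nat.card_prod]
    refine Nat.card_congr ⟨fun f => (f.comp SimpleGraph.Embedding.sumInl.toHom,
      f.comp SimpleGraph.Embedding.sumInr.toHom), fun f => ⟨Sum.elim f.1 f.2, ?_⟩, ?_, ?_⟩
    · rintro (i | i) (j | j) h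
      · exact f.1.map_adj (by simpa using h)
      · simp at h
      · simp at h
      · exact f.2.map_adj (by simpa using h)
    · intro f
      ext (i | i) <;> rfl
    · intro f
      rfl
  simp only [homDensity, e, Fintype.card_sum, pow_add, Nat.cast_mul]
  rw [mul_div_mul_comm]

/-- The limit of the homomorphism densities of `F`, as an integral over the birth times `t` of the
vertices. -/
noncomputable def limitDensity {V : Type*} [Fintype V] (ν : Measure I) (F : SimpleGraph V) : ℝ :=
  ∫ t : V → I, ∏ j, ∫ x : I, (x : ℝ) ^ backDegree F t j ∂ν

/-- Back degrees count only neighbours, which lie in the same component graph, so the integrand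
splits into functions of separate coordinates. -/
theorem limitDensity_sum {V V' : Type*} [Fintype V] [Fintype V'] (ν : Measure I)
    (F : SimpleGraph V) (F' : SimpleGraph V') :
    limitDensity ν (F ⊕g F') = limitDensity ν F * limitDensity ν F' := by
  have hl : ∀ (t : V ⊕ V' → I) (j : V),
      backDegree (F ⊕g F') t (.inl j) = backDegree F (fun i => t (.inl i)) j := fun t j => by
    refine Nat.card_congr (Equiv.symm (Equiv.ofBijective
      (fun i => ⟨.inl i.1, by simpa using i.2.1, i.2.2⟩)
      ⟨fun i i' h => Subtype.ext (by simpa using h), ?_⟩))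
    rintro ⟨i | i, h, h'⟩
    · exact ⟨⟨i, by simpa using h, h'⟩, rfl⟩
    · simp at h
  have hr : ∀ (t : V ⊕ V' → I) (j : V'),
      backDegree (F ⊕g F') t (.inr j) = backDegree F' (fun i => t (.inr i)) j := fun t j => by
    refine Nat.card_congr (Equiv.symm (Equiv.ofBijective
      (fun i => ⟨.inr i.1, by simpa using i.2.1, i.2.2⟩)
      ⟨fun i i' h => Subtype.ext (by simpa using h), ?_⟩))
    rintro ⟨i | i, h, h'⟩
    · simp at h
    · exact ⟨⟨i, by simpa using h, h'⟩, rfl⟩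
  simp only [limitDensity, Fintype.prod_sum_type, hl, hr]
  rw [← integral_prod_mul]
  exact (volume_measurePreserving_sumPiEquivProdPi fun _ : V ⊕ V' => I).integral_comp'
    (g := fun z : (V → I) × (V' → I) => (∏ j, ∫ x : I, (x : ℝ) ^ backDegree F z.1 j ∂ν) *
      ∏ j, ∫ x : I, (x : ℝ) ^ backDegree F' z.2 j ∂ν)

/-! ### Limit of the expected homomorphism densities -/

namespace IsSequentialConstruction

variable {Ω : Type*} [MeasurableSpace Ω] {P : Measure Ω}
  {νs : (n : ℕ) → PMF (Fin (n + 1))} {D : (n : ℕ) → Ω → Fin (n + 1)}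
  {N : (n : ℕ) → Ω → Finset (Fin n)} {G : (n : ℕ) → Ω → SimpleGraph (Fin n)}

theorem integral_homDensity [IsProbabilityMeasure P] (hG : IsSequentialConstruction P νs D N G)
    {V : Type*} [Fintype V] (F : SimpleGraph V) (n : ℕ) :
    ∫ ω, homDensity F (G (n + 1) ω) ∂P = ∫ t : V → I, P.real
      {ω | ∀ i j, F.Adj i j → (G (n + 1) ω).Adj (gridCell n (t i)) (gridCell n (t j))} := by
  classical
  have hmeas : ∀ φ : V → Fin (n + 1),
      MeasurableSet {ω | ∀ i j, F.Adj i j → (G (n + 1) ω).Adj (φ i) (φ j)} := fun φ =>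
    hG.measurable_G (n + 1) (t := {K | ∀ i j, F.Adj i j → K.Adj (φ i) (φ j)})
      MeasurableSpace.measurableSet_top
  rw [integral_gridCell n
    fun φ => P.real {ω | ∀ i j, F.Adj i j → (G (n + 1) ω).Adj (φ i) (φ j)}]
  simp only [homDensity_eq_sum]
  rw [integral_div, integral_finsetSum]
  · congr 1
    refine Finset.sum_congr rfl fun φ _ => ?_
    exact integral_indicator_one (hmeas φ)
  · intro φ _
    exact (integrable_const (1 : ℝ)).indicator (hmeas φ)

/-- For fixed distinct times in (0,1), the cells eventually have the same order as the times, so the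
back degrees stabilise; meanwhile all birth indices tend to infinity. -/
theorem tendsto_real_hom_gridCell [IsProbabilityMeasure P]
    (hG : IsSequentialConstruction P νs D N G) {ν : Measure I} [IsProbabilityMeasure ν]
    (hD : TendstoInDistribution (fun n ω => ((D n ω : ℕ) : ℝ) / ((n : ℝ) + 1)) atTop
      (fun x : I => (x : ℝ)) (fun _ => P) ν) {V : Type*} [Fintype V] (F : SimpleGraph V)
    {t : V → I} (ht : Function.Injective t) (h01 : ∀ j, 0 < (t j : ℝ) ∧ (t j : ℝ) < 1) :
    Tendsto (fun n => P.real
      {ω | ∀ i j, F.Adj i j → (G (n + 1) ω).Adj (gridCell n (t i)) (gridCell n (t j))}) atTop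
      (𝓝 (∏ j, ∫ x : I, (x : ℝ) ^ backDegree F t j ∂ν)) := by
  have h : Tendsto (fun n => ∏ j, attachProb P D (gridCell n (t j)) (backDegree F t j)) atTop
      (𝓝 (∏ j, ∫ x : I, (x : ℝ) ^ backDegree F t j ∂ν)) :=
    tendsto_finsetProd _ fun j _ => (tendsto_attachProb hG.measurable_D hD _).comp
      (tendsto_coe_gridCell (h01 j).1 (h01 j).2)
  refine h.congr' ?_
  filter_upwards [eventually_gridCell_lt_iff ht fun j => (h01 j).2] with n hn
  have hinj : Function.Injective fun j => gridCell n (t j) := by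
    intro i j hij
    by_contra hne
    rcases lt_or_gt_of_ne (ht.ne hne) with h' | h'
    · exact ((hn i j).2 h').ne hij
    · exact ((hn j i).2 h').ne hij.symm
  rw [hG.real_hom F hinj]
  simp only [backDegree, hn]

theorem tendsto_integral_homDensity [IsProbabilityMeasure P]
    (hG : IsSequentialConstruction P νs D N G) {ν : Measure I} [IsProbabilityMeasure ν]
    (hD : TendstoInDistribution (fun n ω => ((D n ω : ℕ) : ℝ) / ((n : ℝ) + 1)) atTop
      (fun x : I => (x : ℝ)) (fun _ => P) ν) {V : Type*} [Fintype V] (F : SimpleGraph V) :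
    Tendsto (fun n => ∫ ω, homDensity F (G (n + 1) ω) ∂P) atTop (𝓝 (limitDensity ν F)) := by
  simp only [hG.integral_homDensity]
  refine tendsto_integral_of_dominated_convergence (fun _ => 1) (fun n => ?_)
    (integrable_const _) (fun n => ?_) ?_
  · exact ((Measurable.of_discrete (f := fun φ : V → Fin (n + 1) =>
      P.real {ω | ∀ i j, F.Adj i j → (G (n + 1) ω).Adj (φ i) (φ j)})).comp
      (measurable_pi_lambda _ fun j =>
        (measurable_gridCell n).comp (measurable_pi_apply j))).aestronglyMeasurable
  · exact Eventually.of_forall fun t => by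
      rw [Real.norm_of_nonneg measureReal_nonneg]
      exact measureReal_le_one
  · filter_upwards [ae_injective V, ae_coe_mem_Ioo V] with t ht h01
    exact hG.tendsto_real_hom_gridCell hD F ht h01

end IsSequentialConstruction

/-! ### Homomorphism densities of the growth graphon -/

open Classical in
-- Each edge contributes the `s`-value of its endpoint with larger `t`, so `s j` occurs once for
-- each neighbour preceding `j`.
theorem prod_edges_growthGraphon {V : Type*} [Fintype V] [LinearOrder V] (F : SimpleGraph V)
    (s : V → I) {t : V → I} (ht : Function.Injective t) :
    ∏ p : V × V with p.1 < p.2 ∧ F.Adj p.1 p.2,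
      growthGraphon.toFun (s p.1, t p.1) (s p.2, t p.2) = ∏ j, (s j : ℝ) ^ backDegree F t j := by
  have e1 : ∏ j, (s j : ℝ) ^ backDegree F t j =
      ∏ p : V × V with F.Adj p.1 p.2 ∧ t p.1 < t p.2, (s p.2 : ℝ) := by
    rw [Finset.prod_filter, Fintype.prod_prod_type_right]
    refine Finset.prod_congr rfl fun j _ => ?_
    rw [← Finset.prod_filter]
    dsimp only
    rw [Finset.prod_const, backDegree, Nat.card_eq_fintype_card, Fintype.card_subtype]
  rw [e1]
  -- Reorient each edge from the order on `V` to the order given by `t`, and back.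
  refine Finset.prod_bij' (fun p _ => if t p.1 < t p.2 then p else p.swap)
    (fun p _ => if p.1 < p.2 then p else p.swap) ?_ ?_ ?_ ?_ ?_
  · rintro ⟨i, j⟩ h
    simp only [Finset.mem_filter, Finset.mem_univ, true_and] at h ⊢
    have hne := ht.ne h.1.ne
    split_ifs with h'
    · exact ⟨h.2, h'⟩
    · exact ⟨h.2.symm, lt_of_le_of_ne (not_lt.1 h') hne.symm⟩
  · rintro ⟨i, j⟩ h
    simp only [Finset.mem_filter, Finset.mem_univ, true_and] at h ⊢
    split_ifs with h'
    · exact ⟨h', h.1⟩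
    · exact ⟨lt_of_le_of_ne (not_lt.1 h') h.1.ne.symm, h.1.symm⟩
  · rintro ⟨i, j⟩ h
    simp only [Finset.mem_filter, Finset.mem_univ, true_and] at h ⊢
    split_ifs <;> simp_all [h.1.not_gt]
  · rintro ⟨i, j⟩ h
    simp only [Finset.mem_filter, Finset.mem_univ, true_and] at h ⊢
    split_ifs <;> simp_all [h.2.not_gt]
  · rintro ⟨i, j⟩ h
    simp only [Finset.mem_filter, Finset.mem_univ, true_and] at h ⊢
    have hne := ht.ne h.1.ne
    by_cases h' : t i < t j
    · simp [growthGraphon, h']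
    · simp [growthGraphon, h', lt_of_le_of_ne (not_lt.1 h') hne.symm]

theorem homDensity_growthGraphon (ν : Measure I) [IsProbabilityMeasure ν] (F : FinGraph) :
    growthGraphon.homDensity (ν.prod volume) F = limitDensity ν F.2 := by
  classical
  have hmp := measurePreserving_arrowProdEquivProdArrow I I (Fin (F.1 + 1)) (fun _ => ν)
    (fun _ => volume)
  set Φ : (Fin (F.1 + 1) → I) × (Fin (F.1 + 1) → I) → ℝ := fun z =>
    ∏ p : Fin (F.1 + 1) × Fin (F.1 + 1) with p.1 < p.2 ∧ F.2.Adj p.1 p.2,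
      growthGraphon.toFun (z.1 p.1, z.2 p.1) (z.1 p.2, z.2 p.2) with hΦ
  have hΦm : Measurable Φ := by
    refine Finset.measurable_prod _ fun p _ => ?_
    exact growthGraphon.measurable'.comp (f := fun z : (Fin (F.1 + 1) → I) × (Fin (F.1 + 1) → I) =>
      ((z.1 p.1, z.2 p.1), (z.1 p.2, z.2 p.2))) (by fun_prop)
  have hΦi : Integrable Φ ((Measure.pi fun _ => ν).prod (Measure.pi fun _ => volume)) := by
    refine Integrable.of_bound hΦm.aestronglyMeasurable 1 (Eventually.of_forall fun z => ?_)
    rw [Real.norm_of_nonneg (Finset.prod_nonneg fun p _ => (growthGraphon.mem_Icc' _ _).1)]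
    exact Finset.prod_le_one (fun p _ => (growthGraphon.mem_Icc' _ _).1)
      fun p _ => (growthGraphon.mem_Icc' _ _).2
  have e1 : growthGraphon.homDensity (ν.prod volume) F =
      ∫ z, Φ z ∂((Measure.pi fun _ => ν).prod (Measure.pi fun _ => volume)) := by
    rw [← hmp.integral_comp', Graphon.homDensity]
    refine integral_congr_ae (Eventually.of_forall fun x => ?_)
    refine Finset.prod_congr ?_ fun p _ => rfl
    ext; simp
  -- Integrate over `s` first with `t` fixed: the coordinates of `s` are independent, so the
  -- monomial integrates to a product of moments.
  rw [e1, integral_prod_symm _ hΦi, limitDensity, volume_pi]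
  refine integral_congr_ae ?_
  filter_upwards [ae_injective (Fin (F.1 + 1))] with t ht
  rw [← integral_fintype_prod_eq_prod (μ := fun _ => ν)
    (fun j (x : I) => (x : ℝ) ^ backDegree F.2 t j)]
  exact integral_congr_ae (Eventually.of_forall fun s => prod_edges_growthGraphon F.2 s ht)

/-! ### Convergence in probability -/

/-- The sets of pairs `(n, ω)` whose sections at `n` have probability tending to one. -/
def inProbFilter {Ω : Type*} [MeasurableSpace Ω] (P : Measure Ω) : Filter (ℕ × Ω) where
  sets := {A | Tendsto (fun n => P {ω | (n, ω) ∉ A}) atTop (𝓝 0)}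
  univ_sets := by simp
  sets_of_superset {A B} hA hAB := tendsto_of_tendsto_of_tendsto_of_le_of_le tendsto_const_nhds hA
    (fun _ => zero_le) fun n => measure_mono fun _ hω h => hω (hAB h)
  inter_sets {A B} hA hB := by
    have h : Tendsto (fun n => P {ω | (n, ω) ∉ A} + P {ω | (n, ω) ∉ B}) atTop (𝓝 0) := by
      simpa using Tendsto.add hA hB
    refine tendsto_of_tendsto_of_tendsto_of_le_of_le tendsto_const_nhds h
      (fun _ => zero_le) fun n => (measure_mono fun ω hω => ?_).trans (measure_union_le _ _)
    exact not_and_or.1 hω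

theorem mem_inProbFilter {Ω : Type*} [MeasurableSpace Ω] {P : Measure Ω} {A : Set (ℕ × Ω)} :
    A ∈ inProbFilter P ↔ Tendsto (fun n => P {ω | (n, ω) ∉ A}) atTop (𝓝 0) :=
  Iff.rfl

/-- Turns convergence in probability into convergence along a filter, so that products, subspaces
and closures are handled by general topology. -/
theorem tendstoInProb_iff_tendsto {Ω S : Type*} [MeasurableSpace Ω] [TopologicalSpace S]
    {P : Measure Ω} {X : ℕ → Ω → S} {x : S} :
    TendstoInProb P X x ↔ Tendsto (fun z : ℕ × Ω => X z.1 z.2) (inProbFilter P) (𝓝 x) :=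
  Iff.rfl

instance {Ω : Type*} [MeasurableSpace Ω] (P : Measure Ω) [IsProbabilityMeasure P] :
    (inProbFilter P).NeBot := by
  refine ⟨fun h => ?_⟩
  have h0 : (∅ : Set (ℕ × Ω)) ∈ inProbFilter P := h ▸ mem_bot
  rw [mem_inProbFilter] at h0
  simp at h0

theorem tendsto_fst_inProbFilter {Ω : Type*} [MeasurableSpace Ω] (P : Measure Ω) :
    Tendsto Prod.fst (inProbFilter P) atTop := by
  intro A hA
  refine tendsto_const_nhds.congr' ?_
  filter_upwards [hA] with n hn
  simp [hn]

/-- Expanding the square gives E(X - c)² → c² - 2c·c + c² = 0; then apply Markov's inequality to (X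
- c)². -/
theorem tendstoInProb_of_tendsto_integral {Ω : Type*} [MeasurableSpace Ω] {P : Measure Ω}
    [IsProbabilityMeasure P] {X : ℕ → Ω → ℝ} {c : ℝ} (hX : ∀ n, MemLp (X n) 2 P)
    (h1 : Tendsto (fun n => ∫ ω, X n ω ∂P) atTop (𝓝 c))
    (h2 : Tendsto (fun n => ∫ ω, X n ω ^ 2 ∂P) atTop (𝓝 (c ^ 2))) : TendstoInProb P X c := by
  rw [tendstoInProb_iff_tendstoInMeasure]
  have hi : ∀ n, Integrable (fun ω => (X n ω - c) ^ 2) P := fun n =>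
    ((hX n).sub (memLp_const c)).integrable_sq
  have h3 : Tendsto (fun n => ∫ ω, (X n ω - c) ^ 2 ∂P) atTop (𝓝 0) := by
    have h := (h2.sub (h1.const_mul (2 * c))).add_const (c ^ 2)
    rw [show c ^ 2 - 2 * c * c + c ^ 2 = 0 by ring] at h
    refine h.congr fun n => ?_
    have hX1 : Integrable (X n) P := (hX n).integrable one_le_two
    have e : ∀ ω, (X n ω - c) ^ 2 = X n ω ^ 2 - 2 * c * X n ω + c ^ 2 := fun ω => by ring
    simp only [e]
    have hs : Integrable (fun ω => X n ω ^ 2 - 2 * c * X n ω) P :=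
      (hX n).integrable_sq.sub (hX1.const_mul _)
    rw [integral_add hs (integrable_const _), integral_sub (hX n).integrable_sq (hX1.const_mul _), integral_const_mul]
    simp
  rw [tendstoInMeasure_iff_measureReal_dist]
  intro ε hε
  have h4 : Tendsto (fun n => (ε ^ 2)⁻¹ * ∫ ω, (X n ω - c) ^ 2 ∂P) atTop (𝓝 0) := by
    simpa using h3.const_mul (ε ^ 2)⁻¹
  refine squeeze_zero (fun n => measureReal_nonneg) (fun n => ?_) h4
  have h5 := mul_meas_ge_le_integral_of_nonneg
    (Eventually.of_forall fun ω => sq_nonneg (X n ω - c)) (hi n) (ε ^ 2)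
  have e : {ω | ε ≤ dist (X n ω) c} = {ω | ε ^ 2 ≤ (X n ω - c) ^ 2} := by
    ext ω
    change ε ≤ dist (X n ω) c ↔ ε ^ 2 ≤ (X n ω - c) ^ 2
    rw [Real.dist_eq, ← sq_abs (X n ω - c), sq_le_sq₀ hε.le (abs_nonneg _)]
  rw [e, inv_mul_eq_div, le_div_iff₀' (by positivity)]
  exact h5

theorem homDensity_nonneg {V W : Type*} [Fintype V] [Fintype W] (F : SimpleGraph V)
    (K : SimpleGraph W) : 0 ≤ homDensity F K := by
  unfold homDensity
  positivity

theorem homDensity_le_one {V W : Type*} [Fintype V] [Fintype W] (F : SimpleGraph V)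
    (K : SimpleGraph W) : homDensity F K ≤ 1 := by
  classical
  refine div_le_one_of_le₀ ?_ (by positivity)
  have h := Nat.card_le_card_of_injective (fun f : F →g K => (f : V → W)) DFunLike.coe_injective
  rw [Nat.card_eq_fintype_card (α := V → W), Fintype.card_fun] at h
  exact_mod_cast h

namespace IsSequentialConstruction

variable {Ω : Type*} [MeasurableSpace Ω] {P : Measure Ω}
  {νs : (n : ℕ) → PMF (Fin (n + 1))} {D : (n : ℕ) → Ω → Fin (n + 1)}
  {N : (n : ℕ) → Ω → Finset (Fin n)} {G : (n : ℕ) → Ω → SimpleGraph (Fin n)}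

theorem tendstoInProb_homDensity [IsProbabilityMeasure P]
    (hG : IsSequentialConstruction P νs D N G) {ν : Measure I} [IsProbabilityMeasure ν]
    (hD : TendstoInDistribution (fun n ω => ((D n ω : ℕ) : ℝ) / ((n : ℝ) + 1)) atTop
      (fun x : I => (x : ℝ)) (fun _ => P) ν) {V : Type*} [Fintype V] (F : SimpleGraph V) :
    TendstoInProb P (fun n ω => homDensity F (G (n + 1) ω)) (limitDensity ν F) := by
  refine tendstoInProb_of_tendsto_integral (fun n => ?_) (hG.tendsto_integral_homDensity hD F) ?_
  · have hm : Measurable fun K : SimpleGraph (Fin (n + 1)) => homDensity F K := measurable_from_top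
    refine MemLp.of_bound (hm.comp (hG.measurable_G (n + 1))).aestronglyMeasurable 1
      (Eventually.of_forall fun ω => ?_)
    rw [Real.norm_of_nonneg (homDensity_nonneg _ _)]
    exact homDensity_le_one _ _
  -- The second moment for `F` is the first moment for two disjoint copies of `F`.
  · have h := hG.tendsto_integral_homDensity hD (F ⊕g F)
    simpa only [homDensity_sum, limitDensity_sum, ← sq] using h

end IsSequentialConstruction

end GraphLimits

theorem theorem5p3 {Ω : Type*} [MeasurableSpace Ω] (P : Measure Ω) [IsProbabilityMeasure P]
    (νs : (n : ℕ) → PMF (Fin (n + 1))) (D : (n : ℕ) → Ω → Fin (n + 1))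
    (N : (n : ℕ) → Ω → Finset (Fin n)) (G : (n : ℕ) → Ω → SimpleGraph (Fin n))
    (hG : IsSequentialConstruction P νs D N G)
    (ν : Measure I) [IsProbabilityMeasure ν]
    (hD : TendstoInDistribution (fun n ω => ((D n ω : ℕ) : ℝ) / ((n : ℝ) + 1)) atTop
      (fun x : I => (x : ℝ)) (fun _ => P) ν) :
    ∃ hΓ : growthGraphon.limitCoords (ν.prod volume) ∈ closure (Set.range graphCoords),
      TendstoInProb P (fun n ω => GraphSpace.ofGraph ⟨n, G (n + 1) ω⟩)
        (⟨growthGraphon.limitCoords (ν.prod volume), hΓ⟩ : GraphSpace) := by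
  have hF : ∀ F : FinGraph, Tendsto (fun z : ℕ × Ω => homDensity F.2 (G (z.1 + 1) z.2))
      (inProbFilter P) (𝓝 (limitDensity ν F.2)) := fun F =>
    (tendstoInProb_iff_tendsto (X := fun n ω => homDensity F.2 (G (n + 1) ω))).1
      (hG.tendstoInProb_homDensity hD F.2)
  have hn : Tendsto (fun z : ℕ × Ω => 1 / ((z.1 : ℝ) + 1)) (inProbFilter P) (𝓝 0) :=
    tendsto_one_div_add_atTop_nhds_zero_nat.comp (tendsto_fst_inProbFilter P)
  have hW : growthGraphon.limitCoords (ν.prod volume) =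
      (fun F : FinGraph => limitDensity ν F.2, 0) :=
    Prod.ext (funext fun F => homDensity_growthGraphon ν F) rfl
  have h : Tendsto (fun z : ℕ × Ω => graphCoords ⟨z.1, G (z.1 + 1) z.2⟩) (inProbFilter P)
      (𝓝 (growthGraphon.limitCoords (ν.prod volume))) := by
    rw [hW]
    exact (tendsto_pi_nhds.2 hF).prodMk_nhds hn
  -- The filter is proper because `P` has mass one, so the limit of graph coordinates lies in their
  -- closure.
  refine ⟨mem_closure_of_tendsto h (Eventually.of_forall fun z => Set.mem_range_self _), ?_⟩
  rw [tendstoInProb_iff_tendsto]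
  exact tendsto_subtype_rng.2 h
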